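/- Let $(F,v)$ be a Henselian valued field: $v$ is a valuation of arbitrary rank (possibly trivial) on the field $F$, and Hensel's lemma on lifting simple roots holds in its valuation ring. Let $F_s$ be a separable closure of $F$, and denote the extension of $v$ to $F_s$ also by $v$, written additively. Put $$G_0=\{\sigma\in\mathrm{Gal}(F_s/F) : v(\sigma x-x)>0 \text{ for each } x\in F_s \text{ with } v(x)\ge 0\},$$ $$G_1=\{\sigma\in\mathrm{Gal}(F_s/F) : v\left(\tfrac{\sigma x}{x}-1\right)>0 \text{ for each } x\in F_s^\times\}$$ (the inertia group and the ramification group), and let $F_u$ and $F_r$ be the fixed fields in $F_s$ of $G_0$ and $G_1$ (the inertia field and the ramification field of $F$). Then $F\subseteq F_u\subseteq F_r\subseteq F_s$, and: (a) There is a field $F'$ with $F\subseteq F'\subseteq F_s$ such that $F_uF'=F_r$ and $F_u\cap F'=F$. (b) The sequence $$1\to\mathrm{Gal}(F_r/F_u)\to\mathrm{Gal}(F_r/F)\to\mathrm{Gal}(F_u/F)\to 1,$$ given by inclusion and restriction, is exact and splits as a sequence of profinite groups: there is a continuous homomorphism $\mathrm{Gal}(F_u/F)\to\mathrm{Gal}(F_r/F)$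 that is a section of the restriction map. -/

import Mathlib

namespace ValuedGalois

section Groups

variable (F : Type*) {N Γ : Type*} [Field F] [Field N] [Algebra F N]
  [LinearOrderedCommGroupWithZero Γ] (w : Valuation N Γ)

/-- The inertia group: all `σ ∈ Gal(N/F)` such that `σ x - x` lies in the maximal ideal of the
valuation ring for each `x` of the valuation ring. (Valuations are written multiplicatively:
`v(x) ≥ 0` reads `w x ≤ 1`, and `v(x) > 0` reads `w x < 1`.) -/
def inertiaGroup : Subgroup Gal(N/F) where
  carrier := {σ | ∀ x : N, w x ≤ 1 → w (σ x - x) < 1}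
  one_mem' := by
    intro x _
    simp
  mul_mem' := by
    intro σ τ hσ hτ x hx
    have h1 : w (τ x - x) < 1 := hτ x hx
    have h2 : w (τ x) ≤ 1 := by
      have := w.map_add_le h1.le hx
      simpa using this
    have h3 : w (σ (τ x) - τ x) < 1 := hσ _ h2
    have h4 := w.map_add_lt h3 h1
    simpa using h4
  inv_mem' := by
    intro σ hσ x hx
    obtain ⟨y, rfl⟩ := σ.surjective x
    have hs : σ⁻¹ (σ y) = y := σ.symm_apply_apply y
    rw [hs, w.map_sub_swap]
    refine hσ y ?_
    by_contra hy
    have hy := not_le.mp hy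
    have hy0 : y ≠ 0 := by
      rintro rfl
      simp at hy
    have h1 : w y⁻¹ < 1 := by
      rw [map_inv₀]
      exact inv_lt_one_of_one_lt₀ hy
    have h2 : w (σ y⁻¹ - y⁻¹) < 1 := hσ _ h1.le
    have h3 : w (σ y⁻¹) < 1 := by
      have := w.map_add_lt h2 h1
      simpa using this
    rw [map_inv₀, map_inv₀] at h3
    have hσy : 0 < w (σ y) := by
      rw [zero_lt_iff, w.ne_zero_iff]
      simpa using hy0
    exact absurd ((inv_lt_one₀ hσy).mp h3) (not_lt.mpr hx)

/-- The ramification group: all `σ ∈ Gal(N/F)` such that `σ x / x - 1` lies in the maximal ideal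
of the valuation ring for each nonzero `x` of `N`. -/
def ramificationGroup : Subgroup Gal(N/F) where
  carrier := {σ | ∀ x : N, x ≠ 0 → w (σ x / x - 1) < 1}
  one_mem' := by
    intro x hx
    simp [hx]
  mul_mem' := by
    intro σ τ hσ hτ x hx
    have hτx : τ x ≠ 0 := by simpa using hx
    have h1 : w (τ x / x - 1) < 1 := hτ x hx
    have h2 : w (σ (τ x) / τ x - 1) < 1 := hσ _ hτx
    have h3 : w (τ x / x) ≤ 1 := by
      have := w.map_add_le h1.le w.map_one.le
      simpa using this
    have h4 : w ((σ (τ x) / τ x - 1) * (τ x / x)) < 1 := by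
      rw [map_mul]
      exact mul_lt_one_of_lt_of_le h2 h3
    have h5 := w.map_add_lt h4 h1
    have h6 : (σ (τ x) / τ x - 1) * (τ x / x) + (τ x / x - 1) = σ (τ x) / x - 1 := by
      field_simp
      ring
    rw [h6] at h5
    exact h5
  inv_mem' := by
    intro σ hσ x hx
    obtain ⟨y, rfl⟩ := σ.surjective x
    have hy : y ≠ 0 := by
      rintro rfl
      simp at hx
    change w (σ⁻¹ (σ y) / σ y - 1) < 1
    have hs : σ⁻¹ (σ y) = y := σ.symm_apply_apply y
    have h1 : w (σ y / y - 1) < 1 := hσ y hy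
    have h2 : w (σ y / y) = 1 := by
      have := w.map_one_add_of_lt h1
      simpa using this
    have h3 : y / σ y - 1 = -((σ y / y - 1) / (σ y / y)) := by
      field_simp
      ring
    rw [hs, h3, w.map_neg, map_div₀, h2, div_one]
    exact h1

/-- The ramification group is contained in the inertia group. -/
theorem ramificationGroup_le_inertiaGroup : ramificationGroup F w ≤ inertiaGroup F w := by
  intro σ hσ x hx
  by_cases h0 : x = 0
  · simp [h0]
  have h1 : w (σ x / x - 1) < 1 := hσ x h0
  have h2 : σ x - x = (σ x / x - 1) * x := by
    field_simp
  rw [h2, map_mul]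
  exact mul_lt_one_of_lt_of_le h1 hx

/-- The fixed field of the inertia group. -/
noncomputable def inertiaField : IntermediateField F N :=
  IntermediateField.fixedField (inertiaGroup F w)

/-- The fixed field of the ramification group. -/
noncomputable def ramificationField : IntermediateField F N :=
  IntermediateField.fixedField (ramificationGroup F w)

theorem inertiaField_le_ramificationField : inertiaField F w ≤ ramificationField F w :=
  IntermediateField.fixedField_antitone (ramificationGroup_le_inertiaGroup F w)

end Groups

section Sequence

variable {F N : Type*} [Field F] [Field N] [Algebra F N]

/-- For intermediate fields `K ≤ L` of `N/F`, a short exact sequence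
`1 → Gal(L/K) → Gal(L/F) → Gal(K/F) → 1` is the canonical one if its first map is the inclusion
(it does not change the underlying map `L → L`) and its second map is restriction to `K`.
`IntermediateField.extendScalars h` is `L`, regarded as an extension of `K`. -/
def IsGaloisSequence {K L : IntermediateField F N} (h : K ≤ L)
    (S : GroupExtension Gal(IntermediateField.extendScalars h/K) Gal(L/F) Gal(K/F)) : Prop :=
  (∀ (τ : Gal(IntermediateField.extendScalars h/K)) (x : L),
    ((S.inl τ x : L) : N) =
      (τ (⟨(x : N), x.2⟩ : IntermediateField.extendScalars h) : N)) ∧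
  (∀ (σ : Gal(L/F)) (x : K),
    ((S.rightHom σ x : K) : N) = (σ (IntermediateField.inclusion h x) : N))

/-- The canonical sequence `1 → Gal(L/K) → Gal(L/F) → Gal(K/F) → 1` is exact, and it splits as a
sequence of profinite groups: restriction `Gal(L/F) → Gal(K/F)` has a section that is a
homomorphism and is continuous for the Krull topologies. -/
def GaloisSequenceSplits {K L : IntermediateField F N} (h : K ≤ L) : Prop :=
  ∃ S : GroupExtension Gal(IntermediateField.extendScalars h/K) Gal(L/F) Gal(K/F),
    IsGaloisSequence h S ∧ ∃ s : S.Splitting, Continuous s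

end Sequence

end ValuedGalois

/-! Hensel's lemma makes `w` invariant under Gal(Fs/F): the integral closure of the valuation ring
in a finite Galois extension is local, which forces the valuation ring of `w` to consist of the
integral elements. Hence both groups are normal, and closed in any case, so F_u and F_r are Galois
over F and correspond to them.

The complement F' is F(T), where T ⊇ Fˣ is a maximal group of radicals of exponent prime to the
residue characteristic such that T/Fˣ embeds into the value group of Fs modulo that of F. Three
facts carry the argument.

F_u has the same value group as F (`exists_map_algebraMap_eq_of_mem_inertiaField`). An F-combination
of elements of T can be written with values distinct modulo those of F, so if it lies in F_u, a term
of dominant value lies in F and can be split off; thus F_u ∩ F(T) = F.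

An element of G_1 fixes T, because distinct roots of unity of order prime to the residue
characteristic have distinct residues. Conversely, by maximality the values of Fs modulo those of T
have order a power of the residue characteristic, and there an inertia element fixing T is forced
into G_1 by Frobenius. Thus F_u F(T) = F_r.

Finally, Gal(Fs/F') maps onto Gal(F_u/F), and the kernel acts trivially on F_uF' = F_r; inverting
this map gives the continuous section. -/

section

open Polynomial IsLocalRing
open scoped Pointwise

/-! ### Local rings and integral extensions -/

/-- If a finite group acts on a domain `B` with ring of invariants a Henselian local ring `A`, then
`B` is local. -/
theorem HenselianLocalRing.isLocalRing_of_isInvariant {A B : Type*} (G : Type*) [CommRing A]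
    [HenselianLocalRing A] [CommRing B] [IsDomain B] [Algebra A B] [FaithfulSMul A B] [Group G]
    [Finite G] [MulSemiringAction G B] [SMulCommClass G A B] [Algebra.IsInvariant A B G] :
    IsLocalRing B := by
  classical
  have := Fintype.ofFinite G
  have hint := Algebra.IsInvariant.isIntegral A B G
  have hmem : ∀ M : Ideal B, M.IsMaximal → ∀ a : A, algebraMap A B a ∈ M ↔ a ∈ maximalIdeal A := by
    intro M hM a
    have := Ideal.isMaximal_comap_of_isIntegral_of_isMaximal (R := A) M
    rw [← IsLocalRing.eq_maximalIdeal this, Ideal.mem_comap]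
  have hsmul : ∀ (g : G) (M : Ideal B), M.IsMaximal → (g • M).IsMaximal := by
    intro g M hM
    rw [Ideal.pointwise_smul_eq_comap]
    exact Ideal.comap_isMaximal_of_equiv _
  obtain ⟨M, hM⟩ := Ideal.exists_maximal B
  refine IsLocalRing.of_unique_max_ideal ⟨M, hM, fun M' hM' => ?_⟩
  obtain ⟨g₀, rfl⟩ : ∃ g : G, M' = g • M := by
    apply Algebra.IsInvariant.exists_smul_of_under_eq A
    ext a
    rw [Ideal.mem_comap, Ideal.mem_comap, hmem M hM, hmem M' hM']
  by_contra hne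
  have hcop : ∀ g : G, ∃ e : B, 1 - e ∈ M ∧ (g • M ≠ M → e ∈ g • M) := by
    intro g
    by_cases h : g • M = M
    · exact ⟨1, by simp, fun h' => absurd h h'⟩
    · have h1 : g • M ⊔ M = ⊤ := Ideal.IsMaximal.coprime_of_ne (hsmul g M hM) hM h
      obtain ⟨x, hx, y, hy, hxy⟩ := Submodule.mem_sup.mp ((Ideal.eq_top_iff_one _).mp h1)
      exact ⟨x, by rwa [← hxy, add_sub_cancel_left], fun _ => hx⟩
  choose e he1 he2 using hcop
  set c : B := ∏ g, e g with hc
  have hc1 : 1 - c ∈ M := by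
    rw [← Ideal.Quotient.eq, hc, map_prod, map_one]
    exact (Finset.prod_eq_one fun g _ => ((Ideal.Quotient.eq).mpr (he1 g)).symm).symm
  have hc2 : ∀ g : G, g • M ≠ M → c ∈ g • M := fun g hg =>
    Ideal.mem_of_dvd _ (Finset.dvd_prod_of_mem e (Finset.mem_univ g)) (he2 g hg)
  -- The norm of `c` over the decomposition group of `M` is fixed by that group, is still 1 modulo
  -- `M`, and lies in every other conjugate of `M`.
  let D := MulAction.stabilizer G M
  set b : B := ∏ d : D, (d : G) • c with hb
  have hb1 : 1 - b ∈ M := by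
    rw [← Ideal.Quotient.eq, hb, map_prod, map_one]
    refine (Finset.prod_eq_one fun d _ => ?_).symm
    symm
    rw [← map_one (Ideal.Quotient.mk M), Ideal.Quotient.eq, ← smul_one (d : G), ← smul_sub]
    have := Ideal.smul_mem_pointwise_smul (d : G) _ _ hc1
    rwa [MulAction.mem_stabilizer_iff.mp d.2] at this
  have hbD : ∀ d ∈ D, d • b = b := by
    intro d hd
    rw [hb, Finset.smul_prod']
    refine Fintype.prod_equiv (Equiv.mulLeft (⟨d, hd⟩ : D)) _ _ fun x => ?_
    simp [mul_smul]
  have hb2 : ∀ g : G, g • M ≠ M → g • b ∈ M := by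
    intro g hg
    have h1 : b ∈ g⁻¹ • M := by
      refine Ideal.mem_of_dvd _ (Finset.dvd_prod_of_mem _ (Finset.mem_univ (1 : D))) ?_
      rw [OneMemClass.coe_one, one_smul]
      refine hc2 _ fun h => hg ?_
      rw [inv_smul_eq_iff] at h
      exact h.symm
    have := Ideal.smul_mem_pointwise_smul g _ _ h1
    rwa [smul_inv_smul] at this
  have hstab : ∀ g : G, g • b = b → g ∈ D := by
    intro g hg
    by_contra h
    have h1 := hb2 g h
    rw [hg] at h1
    exact hM.ne_top ((Ideal.eq_top_iff_one _).mpr (by simpa using M.add_mem hb1 h1))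
  -- the polynomial whose roots are the conjugates of `b`
  obtain ⟨f, hf⟩ : prodXSubSMul G B b ∈ Polynomial.lifts (algebraMap A B) := by
    rw [Polynomial.lifts_iff_coeff_lifts]
    intro n
    obtain ⟨a, ha⟩ := Algebra.IsInvariant.isInvariant (A := A) (G := G)
      ((prodXSubSMul G B b).coeff n) fun g => prodXSubSMul.coeff G B b g n
    exact ⟨a, ha⟩
  rw [coe_mapRingHom] at hf
  have hinj := FaithfulSMul.algebraMap_injective A B
  have hmon : f.Monic := by
    apply Polynomial.monic_of_injective hinj
    rw [hf]
    exact prodXSubSMul.monic G B b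
  set q₀ : G ⧸ MulAction.stabilizer G b := ((1 : G) : G ⧸ MulAction.stabilizer G b)
  set h : B[X] := ∏ q ∈ Finset.univ.erase q₀, (X - C (MulAction.ofQuotientStabilizer G b q)) with hh
  have hfac : f.map (algebraMap A B) = (X - C b) * h := by
    rw [hf, prodXSubSMul, hh, ← Finset.mul_prod_erase _ _ (Finset.mem_univ q₀)]
    congr 2
    simp [q₀]
  have hh1 : h.eval 1 - 1 ∈ M := by
    rw [← Ideal.Quotient.eq, hh, eval_prod, map_prod, map_one]
    refine Finset.prod_eq_one fun q hq => ?_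
    induction q using QuotientGroup.induction_on with
    | H g =>
      have hg : g • M ≠ M := by
        intro hg
        apply Finset.ne_of_mem_erase hq
        rw [QuotientGroup.eq, mul_one, inv_mem_iff]
        exact hbD g hg
      rw [← map_one (Ideal.Quotient.mk M), Ideal.Quotient.eq]
      simpa using hb2 g hg
  have hcoe : algebraMap A B 1 = 1 := map_one _
  -- The conjugates of `b` other than `b` itself lie in `M`, so modulo `M` the polynomial is (X -
  -- 1)X^k and 1 is a simple root.
  have heval1 : f.eval 1 ∈ maximalIdeal A := by
    rw [← hmem M hM, ← eval_map_apply, hcoe, hfac, eval_mul]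
    exact Ideal.mul_mem_right _ _ (by simpa using hb1)
  have hder : IsUnit (f.derivative.eval 1) := by
    by_contra hu
    have h1 : f.derivative.eval 1 ∈ maximalIdeal A := hu
    rw [← hmem M hM, ← eval_map_apply, hcoe, ← derivative_map, hfac, derivative_mul,
      eval_add, eval_mul, eval_mul] at h1
    simp only [derivative_sub, derivative_X, derivative_C, sub_zero, eval_one, one_mul, eval_sub,
      eval_X, eval_C] at h1
    have h2 := (Ideal.add_mem_iff_left M (M.mul_mem_right _ hb1)).mp h1
    exact hM.ne_top ((Ideal.eq_top_iff_one _).mpr (by simpa using M.sub_mem h2 hh1))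
  obtain ⟨a, ha, ha1⟩ := HenselianLocalRing.is_henselian f hmon 1 heval1 hder
  have hroot : (prodXSubSMul G B b).eval (algebraMap A B a) = 0 := by
    rw [← hf, eval_map_apply, ha.eq_zero, map_zero]
  rw [prodXSubSMul, eval_prod, Finset.prod_eq_zero_iff] at hroot
  obtain ⟨q, -, hq⟩ := hroot
  induction q using QuotientGroup.induction_on with
  | H g =>
    -- The Hensel root is invariant, so `b` equals it. Then `g₀ • b = b` lies in `M`, although `b`
    -- is 1 modulo `M`.
    have hg : algebraMap A B a = g • b := by simpa [sub_eq_zero] using hq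
    have hba : b = algebraMap A B a := by
      rw [← inv_smul_eq_iff, smul_algebraMap] at hg
      exact hg.symm
    have hg0 := hb2 g₀ hne
    rw [hba, smul_algebraMap, hmem M hM] at hg0
    exact (maximalIdeal.isMaximal A).ne_top
      ((Ideal.eq_top_iff_one _).mpr (by simpa using Ideal.sub_mem _ hg0 ha1))

/-- If `B` is a local ring that is integrally closed in the field `L`, then for each root `x ∈ L` of
a polynomial over `B` with a unit among its coefficients, `x` or `x⁻¹` lies in `B`. -/
theorem IsIntegrallyClosedIn.mem_or_inv_mem_of_aeval_eq_zero {B L : Type*} [CommRing B]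
    [IsLocalRing B] [Field L] [Algebra B L] [IsIntegrallyClosedIn B L] {x : L} (p : B[X])
    (hp : aeval x p = 0) (hu : ∃ i, IsUnit (p.coeff i)) :
    x ∈ (algebraMap B L).range ∨ x⁻¹ ∈ (algebraMap B L).range := by
  induction hn : p.natDegree using Nat.strong_induction_on generalizing p with
  | _ n ih =>
    subst hn
    obtain ⟨c, hc⟩ : ∃ c : B, algebraMap B L c = p.leadingCoeff • x :=
      IsIntegrallyClosedIn.algebraMap_eq_of_integral (isIntegral_leadingCoeff_smul p x hp)
    rw [Algebra.smul_def] at hc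
    rcases Nat.eq_zero_or_pos p.natDegree with h0 | hpos
    · exfalso
      obtain ⟨i, hi⟩ := hu
      rw [eq_C_of_natDegree_eq_zero h0] at hp hi
      rw [coeff_C] at hi
      split_ifs at hi with h
      · rw [aeval_C] at hp
        exact (hi.map (algebraMap B L)).ne_zero hp
      · exact not_isUnit_zero hi
    by_cases hlead : IsUnit p.leadingCoeff
    · left
      obtain ⟨u, hu⟩ := hlead
      refine ⟨↑u⁻¹ * c, ?_⟩
      rw [map_mul, hc, ← mul_assoc, ← map_mul, ← hu, Units.inv_mul, map_one, one_mul]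
    -- As a_n x = c lies in `B`, the term a_n xⁿ can be traded for c xⁿ⁻¹, which lowers the degree.
    set q : B[X] := p.eraseLead + monomial (p.natDegree - 1) c with hq
    have hroot : aeval x q = 0 := by
      have h1 : aeval x p = aeval x p.eraseLead + aeval x (monomial p.natDegree p.leadingCoeff) := by
        rw [← map_add, eraseLead_add_monomial_natDegree_leadingCoeff]
      rw [hq, map_add, ← hp, h1, aeval_monomial, aeval_monomial, hc, mul_assoc, ← pow_succ',
        Nat.sub_add_cancel hpos]
    have hdeg : q.natDegree < p.natDegree := by
      have h1 := eraseLead_natDegree_le p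
      have h2 := natDegree_monomial_le c (m := p.natDegree - 1)
      have h3 := natDegree_add_le p.eraseLead (monomial (p.natDegree - 1) c)
      rw [← hq] at h3
      have := max_le h1 h2
      omega
    by_cases hqu : ∃ i, IsUnit (q.coeff i)
    · exact ih _ hdeg q hroot hqu rfl
    -- If the trade destroys every unit coefficient, the one of `p` sat in degree n - 1 and was
    -- cancelled by `c` modulo the maximal ideal. So `c` is a unit and x⁻¹ = a_n / c.
    · right
      push Not at hqu
      obtain ⟨i, hi⟩ := hu
      have hine : i ≠ p.natDegree := by
        rintro rfl
        exact hlead hi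
      have hqi := hqu i
      rw [hq, coeff_add, eraseLead_coeff_of_ne i hine, coeff_monomial] at hqi
      split_ifs at hqi with h
      · have hcu : IsUnit c := by
          by_contra hcu
          have h1 := (maximalIdeal B).sub_mem (show p.coeff i + c ∈ maximalIdeal B from hqi)
            (show c ∈ maximalIdeal B from hcu)
          rw [add_sub_cancel_right] at h1
          exact h1 hi
        obtain ⟨u, rfl⟩ := hcu
        have hu0 : algebraMap B L u ≠ 0 := (u.isUnit.map (algebraMap B L)).ne_zero
        refine ⟨p.leadingCoeff * ↑u⁻¹, ?_⟩
        have hx0 : x ≠ 0 := by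
          rintro rfl
          exact hu0 (by rw [hc, mul_zero])
        rw [← mul_left_inj' hx0, inv_mul_cancel₀ hx0, map_mul, mul_right_comm, ← hc, ← map_mul, Units.mul_inv,
          map_one]
      · rw [add_zero] at hqi
        exact absurd hi hqi

/-! ### Galois invariance of the extended valuation -/

namespace Valuation.Integers

variable {K Γ A : Type*} [Field K] [LinearOrderedCommGroupWithZero Γ] {v : Valuation K Γ}
  [CommRing A] [Algebra A K]

/-- An algebraic element is a root of a primitive polynomial over the valuation ring. -/
theorem exists_aeval_eq_zero_coeff_eq_one (hv : v.Integers A) {L : Type*} [Field L] [Algebra K L]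
    [Algebra A L] [IsScalarTower A K L] {x : L} (hx : IsAlgebraic K x) :
    ∃ p : A[X], aeval x p = 0 ∧ ∃ i, p.coeff i = 1 := by
  obtain ⟨q, hq0, hq⟩ := hx
  obtain ⟨j, hj, hmax⟩ := q.support.exists_max_image (fun i => v (q.coeff i))
    (support_nonempty.mpr hq0)
  have hj0 : q.coeff j ≠ 0 := mem_support_iff.mp hj
  have hlift : C (q.coeff j)⁻¹ * q ∈ Polynomial.lifts (algebraMap A K) := by
    rw [lifts_iff_coeff_lifts]
    intro n
    refine hv.exists_of_le_one ?_
    rw [coeff_C_mul, map_mul, map_inv₀]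
    by_cases hn : n ∈ q.support
    · exact inv_mul_le_one_of_le₀ (hmax n hn) zero_le
    · simp [notMem_support_iff.mp hn]
  obtain ⟨p, hp⟩ := hlift
  rw [coe_mapRingHom] at hp
  refine ⟨p, ?_, j, hv.hom_inj ?_⟩
  · rw [← aeval_map_algebraMap K, hp, map_mul, hq, mul_zero]
  · rw [← coeff_map, hp, coeff_C_mul, inv_mul_cancel₀ hj0, map_one]

variable [IsDomain A] [IsFractionRing A K] [HenselianLocalRing A]

/-- Since `A` is integrally closed, it is the ring of Galois invariants of its integral closure in
`L`. -/
theorem isLocalRing_integralClosure (hv : v.Integers A) (L : Type*) [Field L] [Algebra K L]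
    [Algebra A L] [IsScalarTower A K L] [FiniteDimensional K L] [IsGalois K L] :
    IsLocalRing (integralClosure A L) := by
  have := hv.isIntegrallyClosed
  have : FaithfulSMul A L := by
    rw [faithfulSMul_iff_algebraMap_injective, IsScalarTower.algebraMap_eq A K L]
    exact (algebraMap K L).injective.comp hv.hom_inj
  have : FaithfulSMul A (integralClosure A L) := by
    rw [faithfulSMul_iff_algebraMap_injective]
    exact fun a b h => FaithfulSMul.algebraMap_injective A L (congrArg Subtype.val h)
  have : IsFractionRing (integralClosure A L) L :=
    integralClosure.isFractionRing_of_finite_extension K L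
  let := IsIntegralClosure.MulSemiringAction A K L (integralClosure A L)
  have := Algebra.isInvariant_of_isGalois A K L (integralClosure A L)
  have : SMulCommClass Gal(L/K) A (integralClosure A L) :=
    ⟨fun g a b => map_smul (galRestrict A K L (integralClosure A L) g) a b⟩
  exact HenselianLocalRing.isLocalRing_of_isInvariant (A := A) Gal(L/K)

variable {N Γ' : Type*} [Field N] [Algebra K N] [Algebra A N] [IsScalarTower A K N] [IsGalois K N]
  [LinearOrderedCommGroupWithZero Γ'] (w : Valuation N Γ')

/-- Over a Henselian valued field, the valuation ring of any extension of the valuation to a Galois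
extension consists of the integral elements. -/
theorem le_one_iff_isIntegral_of_henselian (hv : v.Integers A) [v.HasExtension w]
    (x : N) : w x ≤ 1 ↔ IsIntegral A x := by
  have hint : ∀ y : N, IsIntegral A y → w y ≤ 1 := by
    intro y hy
    obtain ⟨p, hp, hp0⟩ := hy
    refine Valuation.Integers.mem_of_integral (Valuation.integer.integers w)
      ⟨p.map ((algebraMap A N).codRestrict w.integer fun a => ?_), hp.map _, ?_⟩
    · rw [IsScalarTower.algebraMap_apply A K N]
      exact (HasExtension.val_map_le_one_iff v w _).mpr (hv.map_le_one a)
    · rw [eval₂_map]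
      exact hp0
  refine ⟨fun hx => ?_, hint x⟩
  let L := FiniteGaloisIntermediateField.adjoin K {x}
  have hxL : x ∈ L.toIntermediateField :=
    FiniteGaloisIntermediateField.subset_adjoin K {x} rfl
  let y : L := ⟨x, hxL⟩
  have := hv.isLocalRing_integralClosure L
  have : IsScalarTower A L N := IsScalarTower.of_algebraMap_eq fun _ => rfl
  let B := integralClosure A L
  obtain ⟨p, hp, i, hi⟩ := hv.exists_aeval_eq_zero_coeff_eq_one
    (Algebra.IsAlgebraic.isAlgebraic (R := K) y)
  have hcases := IsIntegrallyClosedIn.mem_or_inv_mem_of_aeval_eq_zero (B := B) (x := y)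
    (p.map (algebraMap A B)) (by rwa [aeval_map_algebraMap]) ⟨i, by simp [hi]⟩
  suffices h : ∃ z : B, (z : L) = y by
    obtain ⟨z, hz⟩ := h
    have h1 : IsIntegral A y := hz ▸ z.2
    exact h1.map (IsScalarTower.toAlgHom A L N)
  rcases hcases with ⟨z, hz⟩ | ⟨z, hz⟩
  · exact ⟨z, hz⟩
  have hwB : ∀ b : B, w ((b : L) : N) ≤ 1 := fun b =>
    hint _ (IsIntegral.map (IsScalarTower.toAlgHom A L N) b.2)
  -- Here x⁻¹ lies in `B`. The centre `P` of `w` on `B` lies over the maximal ideal of `A`, so it is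
  -- the maximal ideal of `B`; as w x ≤ 1, x⁻¹ is not in it and is a unit.
  let P : Ideal B :=
    { carrier := {b | w ((b : L) : N) < 1}
      add_mem' := fun {a b} ha hb => by simpa using w.map_add_lt ha hb
      zero_mem' := by simp
      smul_mem' := fun c b hb => by
        simpa [mul_comm] using mul_lt_one_of_lt_of_le hb (hwB c) }
  have hP : P.IsPrime := by
    refine ⟨fun h => ?_, fun {a b} hab => ?_⟩
    · have h1 : (1 : B) ∈ P := h ▸ Submodule.mem_top
      have h2 : w (1 : N) < 1 := h1
      simp at h2
    · by_contra! hcon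
      have h1 : 1 ≤ w ((a : L) : N) := not_lt.mp hcon.1
      have h2 : 1 ≤ w ((b : L) : N) := not_lt.mp hcon.2
      have h3 : w (((a * b : B) : L) : N) < 1 := hab
      refine h3.not_ge ?_
      simpa using one_le_mul h1 h2
  have hPmax : P.IsMaximal := by
    refine Ideal.isMaximal_of_isIntegral_of_isMaximal_comap (R := A) P ?_
    convert maximalIdeal.isMaximal A
    ext a
    rw [mem_maximalIdeal, mem_nonunits_iff, hv.isUnit_iff_valuation_eq_one,
      ← Ne, ← (hv.map_le_one a).lt_iff_ne, ← HasExtension.val_map_lt_one_iff v w,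
      ← IsScalarTower.algebraMap_apply]
    rfl
  rcases eq_or_ne y 0 with hy0 | hy0
  · exact ⟨0, hy0.symm⟩
  replace hz : (z : L) = y⁻¹ := hz
  have hzu : IsUnit z := by
    by_contra hu
    have h1 : z ∈ P := by
      rw [IsLocalRing.eq_maximalIdeal hPmax]
      exact hu
    have h2 : w ((z : L) : N) * w x < 1 := mul_lt_one_of_lt_of_le h1 hx
    have h3 : ((z : L) : N) * x = 1 := by
      have : (z : L) * y = 1 := by rw [hz, inv_mul_cancel₀ hy0]
      exact congrArg Subtype.val this
    rw [← map_mul, h3, map_one] at h2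
    exact lt_irrefl _ h2
  obtain ⟨u, hu⟩ := hzu.exists_right_inv
  refine ⟨u, ?_⟩
  have h1 : (z : L) * u = 1 := congrArg Subtype.val hu
  rw [hz, inv_mul_eq_one₀ hy0] at h1
  exact h1.symm

/-- A valuation extending a Henselian valuation is Galois invariant. -/
theorem map_algEquiv_of_henselian (hv : v.Integers A) [v.HasExtension w] (σ : Gal(N/K)) (x : N) :
    w (σ x) = w x := by
  have hinv : ∀ (τ : Gal(N/K)) (y : N), w y ≤ 1 → w (τ y) ≤ 1 := by
    intro τ y hy
    rw [hv.le_one_iff_isIntegral_of_henselian w] at hy ⊢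
    exact hy.map (τ.toAlgHom.restrictScalars A)
  have hle : ∀ (τ : Gal(N/K)) (x : N), w (τ x) ≤ w x := by
    intro τ x
    by_contra! hlt
    have hx0 : x ≠ 0 := by
      rintro rfl
      simp at hlt
    have hτ0 : ∀ ρ : Gal(N/K), ρ (τ x) ≠ 0 := fun ρ => by simpa using hx0
    -- Powers of `τ` preserve the valuation ring, which contains x / τx. So values grow along the
    -- orbit of `x`, which is finite and returns to `x`.
    have hstep : ∀ n : ℕ, w ((τ ^ n) x) ≤ w ((τ ^ (n + 1)) x) := by
      intro n
      have h1 : w (x / τ x) ≤ 1 := by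
        rw [map_div₀]
        exact div_le_one_of_le₀ hlt.le zero_le
      have h2 := hinv (τ ^ n) _ h1
      rw [map_div₀, map_div₀, div_le_one₀ (zero_lt_iff.mpr ((w.ne_zero_iff).mpr (hτ0 _)))] at h2
      rwa [pow_succ]
    have hmono : Monotone fun n => w ((τ ^ n) x) := monotone_nat_of_le_succ hstep
    obtain ⟨m, hm, hmx⟩ : ∃ m, 0 < m ∧ (τ ^ m) x = x := by
      have hroot : ∀ n : ℕ, (τ ^ n) x ∈ (minpoly K x).rootSet N := by
        intro n
        rw [mem_rootSet]
        refine ⟨minpoly.ne_zero (Algebra.IsIntegral.isIntegral x), ?_⟩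
        rw [aeval_algHom_apply (τ ^ n), minpoly.aeval, map_zero]
      obtain ⟨i, j, hij, heq⟩ := Finite.exists_ne_map_eq_of_infinite
        fun n : ℕ => (⟨(τ ^ n) x, hroot n⟩ : (minpoly K x).rootSet N)
      wlog hlt : i < j generalizing i j
      · exact this j i hij.symm heq.symm (by omega)
      refine ⟨j - i, by omega, (τ ^ i).injective ?_⟩
      rw [← AlgEquiv.mul_apply, ← pow_add, Nat.add_sub_cancel' hlt.le]
      exact (congrArg Subtype.val heq).symm
    have h1 : w ((τ ^ 1) x) ≤ w ((τ ^ m) x) := hmono hm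
    rw [hmx, pow_one] at h1
    exact h1.not_gt hlt
  refine le_antisymm (hle σ x) ?_
  have := hle σ⁻¹ (σ x)
  rwa [← AlgEquiv.mul_apply, inv_mul_cancel, AlgEquiv.one_apply] at this

end Valuation.Integers

/-! ### Lifting automorphisms of the residue field -/

namespace Valuation

/-- If `w` is invariant under the Galois group of `N/K`, then each automorphism of the valued field
`N` that is trivial on the residue field of `K` induces the same automorphism of the residue field
of `N` as some element of the Galois group. -/
theorem exists_algEquiv_lt_one_of_invariant {K N Γ : Type*} [Field K] [Field N] [Algebra K N]
    [IsGalois K N] [LinearOrderedCommGroupWithZero Γ] (w : Valuation N Γ)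
    (hw : ∀ (τ : Gal(N/K)) (x : N), w (τ x) = w x) (σ : N ≃+* N) (hσw : ∀ x, w (σ x) = w x)
    (hσ : ∀ a : K, w (algebraMap K N a) ≤ 1 → w (σ (algebraMap K N a) - algebraMap K N a) < 1) :
    ∃ τ : Gal(N/K), ∀ x, w x ≤ 1 → w (τ x - σ x) < 1 := by
  have : (w.comap (algebraMap K N)).HasExtension w := ⟨IsEquiv.refl⟩
  let A := (w.comap (algebraMap K N)).integer
  let B := w.integer
  let act : MulSemiringAction Gal(N/K) B :=
    { smul := fun τ b => ⟨τ b, (hw τ b).trans_le b.2⟩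
      one_smul := fun b => rfl
      mul_smul := fun τ ρ b => rfl
      smul_zero := fun τ => Subtype.ext (map_zero τ)
      smul_add := fun τ a b => Subtype.ext (map_add τ (a : N) b)
      smul_one := fun τ => Subtype.ext (map_one τ)
      smul_mul := fun τ a b => Subtype.ext (map_mul τ (a : N) b) }
  have hcoe : ∀ (τ : Gal(N/K)) (b : B), ((τ • b : B) : N) = τ b := fun τ b => rfl
  have hcomm : SMulCommClass Gal(N/K) A B := ⟨fun τ a b => Subtype.ext (map_smul τ (a : K) (b : N))⟩
  -- Stabilizers of algebraic elements are open, so the profinite group acts continuously on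
  -- discrete `B`.
  let top : TopologicalSpace B := ⊥
  have hdisc : DiscreteTopology B := ⟨rfl⟩
  have hcont : ContinuousSMul Gal(N/K) B := by
    rw [continuousSMul_iff_stabilizer_isOpen]
    intro b
    convert stabilizer_isOpen_of_isIntegral (K := K) (b : N) using 1
    ext τ
    simp only [SetLike.mem_coe, MulAction.mem_stabilizer_iff, Subtype.ext_iff, hcoe]
    rfl
  have hinv : Algebra.IsInvariant A B Gal(N/K) := by
    refine ⟨fun b hb => ?_⟩
    obtain ⟨a, ha⟩ := (InfiniteGalois.mem_range_algebraMap_iff_fixed (b : N)).mpr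
      fun τ : Gal(N/K) => congrArg Subtype.val (hb τ)
    refine ⟨⟨a, ?_⟩, Subtype.ext ha⟩
    change w (algebraMap K N a) ≤ 1
    rw [ha]
    exact b.2
  let Q : Ideal B :=
    { carrier := {b | w (b : N) < 1}
      add_mem' := fun {a b} ha hb => by simpa using w.map_add_lt ha hb
      zero_mem' := by simp
      smul_mem' := fun c b hb => by
        simpa [mul_comm] using mul_lt_one_of_lt_of_le hb c.2 }
  have hQ : Q.IsPrime := by
    refine ⟨fun h => ?_, fun {a b} hab => ?_⟩
    · have h1 : (1 : B) ∈ Q := h ▸ Submodule.mem_top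
      have h2 : w (1 : N) < 1 := h1
      simp at h2
    · by_contra! hcon
      have h1 : 1 ≤ w (a : N) := not_lt.mp hcon.1
      have h2 : 1 ≤ w (b : N) := not_lt.mp hcon.2
      have h3 : w ((a * b : B) : N) < 1 := hab
      refine h3.not_ge ?_
      simpa using one_le_mul h1 h2
  let P : Ideal A := Q.under A
  let σB : B ≃+* B :=
    { toFun := fun b => ⟨σ b, (hσw b).trans_le b.2⟩
      invFun := fun b => ⟨σ.symm b, by
        rw [mem_integer_iff, ← hσw, σ.apply_symm_apply]
        exact b.2⟩
      left_inv := fun b => Subtype.ext (σ.symm_apply_apply b)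
      right_inv := fun b => Subtype.ext (σ.apply_symm_apply b)
      map_mul' := fun a b => Subtype.ext (map_mul σ _ _)
      map_add' := fun a b => Subtype.ext (map_add σ _ _) }
  have hQσ : Q = Q.map (σB : B →+* B) := by
    refine Eq.trans ?_ (Ideal.comap_symm σB)
    ext b
    change w (b : N) < 1 ↔ w (σ.symm b) < 1
    rw [← hσw (σ.symm b), σ.apply_symm_apply]
  let e : (B ⧸ Q) ≃ₐ[A ⧸ P] (B ⧸ Q) :=
    { Ideal.quotientEquiv Q Q σB hQσ with
      commutes' := by
        rintro ⟨a⟩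
        exact Ideal.Quotient.eq.mpr (hσ a a.2) }
  obtain ⟨τ, hτ⟩ := Ideal.Quotient.stabilizerHom_surjective_of_profinite (G := Gal(N/K)) P Q e
  refine ⟨τ, fun x hx => ?_⟩
  have h1 := DFunLike.congr_fun hτ (Ideal.Quotient.mk Q ⟨x, hx⟩)
  exact Ideal.Quotient.eq.mp h1

end Valuation

/-! ### The inertia field: residues and values -/

namespace ValuedGalois

variable {F N Γ : Type*} [Field F] [Field N] [Algebra F N] [LinearOrderedCommGroupWithZero Γ]
  (w : Valuation N Γ)

theorem isClosed_setOf_apply_mem [Algebra.IsIntegral F N] (x : N) (s : Set N) :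
    IsClosed {σ : Gal(N/F) | σ x ∈ s} := by
  let top : TopologicalSpace N := ⊥
  have hdisc : DiscreteTopology N := ⟨rfl⟩
  have hcont : ContinuousSMul Gal(N/F) N :=
    continuousSMul_iff_stabilizer_isOpen.mpr fun x => stabilizer_isOpen_of_isIntegral x
  exact (isClosed_discrete s).preimage (continuous_id.smul continuous_const)

theorem isClosed_inertiaGroup [Algebra.IsIntegral F N] :
    IsClosed (inertiaGroup F w : Set Gal(N/F)) := by
  have : (inertiaGroup F w : Set Gal(N/F)) =
      ⋂ (x : N) (_ : w x ≤ 1), {σ : Gal(N/F) | σ x ∈ {y | w (y - x) < 1}} := by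
    ext σ
    simp only [Set.mem_iInter, Set.mem_ofPred_eq]
    rfl
  rw [this]
  exact isClosed_iInter fun x => isClosed_iInter fun _ => isClosed_setOf_apply_mem x _

theorem isClosed_ramificationGroup [Algebra.IsIntegral F N] :
    IsClosed (ramificationGroup F w : Set Gal(N/F)) := by
  have : (ramificationGroup F w : Set Gal(N/F)) =
      ⋂ (x : N) (_ : x ≠ 0), {σ : Gal(N/F) | σ x ∈ {y | w (y / x - 1) < 1}} := by
    ext σ
    simp only [Set.mem_iInter, Set.mem_ofPred_eq]
    rfl
  rw [this]
  exact isClosed_iInter fun x => isClosed_iInter fun _ => isClosed_setOf_apply_mem x _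

variable {w}

theorem normal_inertiaGroup (hw : ∀ (σ : Gal(N/F)) (x : N), w (σ x) = w x) :
    (inertiaGroup F w).Normal := by
  refine ⟨fun τ hτ σ x hx => ?_⟩
  have h := hτ (σ⁻¹ x) (by rwa [hw])
  rw [← hw σ, map_sub, ← AlgEquiv.mul_apply σ σ⁻¹, mul_inv_cancel] at h
  exact h

theorem normal_ramificationGroup (hw : ∀ (σ : Gal(N/F)) (x : N), w (σ x) = w x) :
    (ramificationGroup F w).Normal := by
  refine ⟨fun τ hτ σ x hx => ?_⟩
  have h := hτ (σ⁻¹ x) (by simpa using hx)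
  rw [← hw σ, map_sub, map_div₀, map_one, ← AlgEquiv.mul_apply σ σ⁻¹, mul_inv_cancel] at h
  exact h

variable [IsGalois F N]

theorem fixingSubgroup_inertiaField :
    (inertiaField F w).fixingSubgroup = inertiaGroup F w :=
  InfiniteGalois.fixingSubgroup_fixedField ⟨inertiaGroup F w, isClosed_inertiaGroup w⟩

theorem fixingSubgroup_ramificationField :
    (ramificationField F w).fixingSubgroup = ramificationGroup F w :=
  InfiniteGalois.fixingSubgroup_fixedField ⟨ramificationGroup F w, isClosed_ramificationGroup w⟩

theorem isGalois_inertiaField (hw : ∀ (σ : Gal(N/F)) (x : N), w (σ x) = w x) :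
    IsGalois F (inertiaField F w) := by
  rw [← InfiniteGalois.normal_iff_isGalois, fixingSubgroup_inertiaField]
  exact normal_inertiaGroup hw

theorem isGalois_ramificationField (hw : ∀ (σ : Gal(N/F)) (x : N), w (σ x) = w x) :
    IsGalois F (ramificationField F w) := by
  rw [← InfiniteGalois.normal_iff_isGalois, fixingSubgroup_ramificationField]
  exact normal_ramificationGroup hw

/-- An automorphism that is trivial on the residue field of a subextension of the inertia field is
trivial on the subextension. -/
theorem apply_eq_self_of_le_inertiaField (hw : ∀ (σ : Gal(N/F)) (x : N), w (σ x) = w x)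
    {L : IntermediateField F N} (hL : L ≤ inertiaField F w) (σ : Gal(N/F))
    (hσ : ∀ a ∈ L, w a ≤ 1 → w (σ a - a) < 1) {x : N} (hx : x ∈ L) : σ x = x := by
  -- This `τ` fixes `L` and agrees with `σ` on the residue field of `N`, so τ⁻¹σ is in the inertia
  -- group and also fixes `L`.
  obtain ⟨τ, hτ⟩ := w.exists_algEquiv_lt_one_of_invariant (K := L)
    (fun τ x => hw (τ.restrictScalars F) x) σ.toRingEquiv (hw σ) fun a ha => hσ a a.2 ha
  let τ' : Gal(N/F) := τ.restrictScalars F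
  have hmem : τ'⁻¹ * σ ∈ inertiaGroup F w := by
    intro y hy
    have h1 := hτ y hy
    rw [w.map_sub_swap, ← hw τ'⁻¹, map_sub] at h1
    have h2 : τ'⁻¹ (τ y) = y := τ'.symm_apply_apply y
    rw [h2] at h1
    exact h1
  have h1 : τ'⁻¹ (σ x) = x := hL hx ⟨_, hmem⟩
  have h2 : τ' x = x := τ.commutes ⟨x, hx⟩
  calc σ x = τ' (τ'⁻¹ (σ x)) := (τ'.apply_symm_apply _).symm
    _ = x := by rw [h1, h2]

/-- The inertia field has the same value group as the base field. -/
theorem exists_map_algebraMap_eq_of_mem_inertiaField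
    (hw : ∀ (σ : Gal(N/F)) (x : N), w (σ x) = w x) {x : N} (hx : x ∈ inertiaField F w) :
    ∃ a : F, w (algebraMap F N a) = w x := by
  rcases eq_or_ne x 0 with rfl | hx0
  · exact ⟨0, by simp⟩
  have := isGalois_inertiaField hw
  let L := FiniteGaloisIntermediateField.adjoin F {x}
  have hxL : x ∈ L.toIntermediateField := FiniteGaloisIntermediateField.subset_adjoin F {x} rfl
  have hL : L.toIntermediateField ≤ inertiaField F w := by
    simp only [L, FiniteGaloisIntermediateField.adjoin_val,
      IntermediateField.normalClosure_le_iff_of_normal, IntermediateField.adjoin_le_iff,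
      Set.singleton_subset_iff, SetLike.mem_coe]
    exact hx
  have hwL : ∀ (σ : Gal(L/F)) (y : L), w (σ y : L) = w y := by
    intro σ y
    obtain ⟨τ, rfl⟩ := AlgEquiv.restrictNormalHom_surjective (F := F) (K₁ := L) N σ
    rw [AlgEquiv.restrictNormalHom_apply, hw]
  let wL : Valuation L Γ := w.comap (algebraMap L N)
  have hwL' : ∀ (σ : Gal(L/F)) (y : L), wL (σ y) = wL y := hwL
  let B := wL.valuationSubring
  let k := ResidueField B
  have hres : ∀ b : B, residue B b = 0 ↔ wL b < 1 := by
    intro b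
    rw [residue_eq_zero_iff]
    exact wL.mem_maximalIdeal_iff
  let χ : Gal(L/F) → B →* k := fun σ =>
    { toFun := fun b => residue B ⟨σ b, (hwL' σ b).trans_le b.2⟩
      map_one' := by
        rw [← map_one (residue B)]
        congr 1
        exact Subtype.ext (map_one σ)
      map_mul' := fun a b => by
        rw [← map_mul]
        congr 1
        exact Subtype.ext (map_mul σ _ _) }
  have hχ : Function.Injective χ := by
    intro σ τ hστ
    rw [eq_comm, ← inv_mul_eq_one]
    obtain ⟨ρ, hρ⟩ := AlgEquiv.restrictNormalHom_surjective (F := F) (K₁ := L) N (τ⁻¹ * σ)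
    have hρL : ∀ z : L, ((τ⁻¹ * σ) z : N) = ρ z := fun z => by
      rw [← hρ, AlgEquiv.restrictNormalHom_apply]
    ext z
    rw [hρL]
    refine apply_eq_self_of_le_inertiaField hw hL ρ (fun a ha hwa => ?_) z.2
    let b : B := ⟨⟨a, ha⟩, hwa⟩
    have h1 := DFunLike.congr_fun hστ b
    have h2 := (hres _).mp ((map_sub (residue B) _ _).trans (sub_eq_zero.mpr h1))
    have h3 : wL (σ b - τ b) < 1 := h2
    rw [← hwL' τ⁻¹, map_sub, ← AlgEquiv.mul_apply, ← AlgEquiv.mul_apply, inv_mul_cancel] at h3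
    have h4 : w (((τ⁻¹ * σ) b : L) - a) < 1 := h3
    rwa [hρL] at h4
  -- By Dedekind independence of the residue characters, some `b` makes Σ (σy/y) σb a unit.
  -- Multiplied by `y`, this sum is the trace of `b * y`, an element of `F` with the value of `y`.
  have hli := (linearIndependent_monoidHom B k).comp χ hχ
  let y : L := ⟨x, hxL⟩
  have hy0 : y ≠ 0 := fun h => hx0 (congrArg Subtype.val h)
  have hc : ∀ σ : Gal(L/F), wL (σ y / y) = 1 := fun σ => by
    rw [map_div₀, hwL', div_self (wL.ne_zero_iff.mpr hy0)]
  let c : Gal(L/F) → k := fun σ => residue B ⟨σ y / y, (hc σ).le⟩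
  obtain ⟨b, hb⟩ : ∃ b : B, ∑ σ, c σ * χ σ b ≠ 0 := by
    by_contra! hcon
    have h1 := Fintype.linearIndependent_iff.mp hli c (by
      ext b
      simpa using hcon b) 1
    rw [hres] at h1
    have := (hc 1).symm.trans_lt h1
    exact lt_irrefl _ this
  obtain ⟨a, ha⟩ : ∃ a : F, algebraMap F L a = ∑ σ : Gal(L/F), σ (b * y) :=
    ⟨Algebra.trace F L (b * y), trace_eq_sum_automorphisms _⟩
  refine ⟨a, ?_⟩
  have h1 : wL (∑ σ : Gal(L/F), (σ y / y) * σ b) = 1 := by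
    let s : B := ∑ σ : Gal(L/F), ⟨σ y / y, (hc σ).le⟩ * ⟨σ b, (hwL' σ b).trans_le b.2⟩
    have hs : (s : L) = ∑ σ : Gal(L/F), (σ y / y) * σ b := by simp [s]
    have hs0 : residue B s ≠ 0 := by
      rw [map_sum]
      simp only [map_mul]
      exact hb
    rw [← hs]
    exact le_antisymm s.2 (not_lt.mp fun h => hs0 ((hres s).mpr h))
  have h2 : algebraMap F L a = (∑ σ : Gal(L/F), (σ y / y) * σ b) * y := by
    rw [ha, Finset.sum_mul]
    refine Finset.sum_congr rfl fun σ _ => ?_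
    rw [map_mul]
    field_simp
  have h3 : wL (algebraMap F L a) = wL y := by rw [h2, map_mul, h1, one_mul]
  exact h3

end ValuedGalois

/-! ### Tame radical groups -/

namespace ValuedGalois

variable (F : Type*) {N Γ : Type*} [Field F] [Field N] [Algebra F N]
  [LinearOrderedCommGroupWithZero Γ] (w : Valuation N Γ)

/-- A group `T` of elements of `N` that are radical of exponent prime to the residue
characteristic over `F`, such that `T` modulo `Fˣ` maps injectively into the value group of `N`
modulo the value group of `F`. -/
structure IsTameRadicalGroup (T : Subgroup Nˣ) : Prop where
  range_le : (Units.map (algebraMap F N : F →* N)).range ≤ T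
  exists_pow_mem : ∀ t ∈ T, ∃ n : ℕ, w (n : N) = 1 ∧ t ^ n ∈ (Units.map (algebraMap F N : F →* N)).range
  mem_range_of_eq_one : ∀ t ∈ T, w (t : N) = 1 → t ∈ (Units.map (algebraMap F N : F →* N)).range

/-- The group of all elements with the same value as some element of `T`. -/
def valueSaturation (T : Subgroup Nˣ) : Subgroup Nˣ :=
  (T.map (Units.map (w : N →* Γ))).comap (Units.map (w : N →* Γ))

variable {w}

theorem mem_valueSaturation {T : Subgroup Nˣ} {x : Nˣ} :
    x ∈ valueSaturation w T ↔ ∃ t ∈ T, w (t : N) = w (x : N) := by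
  simp [valueSaturation, Subgroup.mem_map, Units.ext_iff]

theorem le_valueSaturation (T : Subgroup Nˣ) : T ≤ valueSaturation w T :=
  Subgroup.le_comap_map _ _

variable (w)

theorem isTameRadicalGroup_range :
    IsTameRadicalGroup F w (Units.map (algebraMap F N : F →* N)).range where
  range_le := le_rfl
  exists_pow_mem t ht := ⟨1, by simp, by simpa using ht⟩
  mem_range_of_eq_one t ht _ := ht

theorem exists_maximal_isTameRadicalGroup : ∃ T, Maximal (IsTameRadicalGroup F w) T := by
  suffices h : ∀ c ⊆ {T : Subgroup Nˣ | IsTameRadicalGroup F w T}, IsChain (· ≤ ·) c → ∀ T₀ ∈ c,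
      ∃ ub ∈ {T : Subgroup Nˣ | IsTameRadicalGroup F w T}, ∀ T ∈ c, T ≤ ub by
    obtain ⟨T, -, hT⟩ := zorn_le_nonempty₀ _ h _ (isTameRadicalGroup_range F w)
    exact ⟨T, hT⟩
  intro c hc hchain T₀ hT₀
  have hmem : ∀ t, t ∈ sSup c ↔ ∃ T ∈ c, t ∈ T := fun t =>
    Subgroup.mem_sSup_of_directedOn ⟨T₀, hT₀⟩ hchain.directedOn
  refine ⟨sSup c, ⟨(hc hT₀).range_le.trans (le_sSup hT₀), fun t ht => ?_, fun t ht => ?_⟩,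
    fun T hT => le_sSup hT⟩
  · obtain ⟨T, hT, ht⟩ := (hmem t).mp ht
    exact (hc hT).exists_pow_mem t ht
  · obtain ⟨T, hT, ht⟩ := (hmem t).mp ht
    exact (hc hT).mem_range_of_eq_one t ht

variable {F w}

/-- The value group of a maximal tame radical group is divisible, within the value group of `N`, by
the primes different from the residue characteristic. -/
theorem mem_valueSaturation_of_pow_mem [IsSepClosed N] {T : Subgroup Nˣ}
    (hT : Maximal (IsTameRadicalGroup F w) T) {l : ℕ} (hl : l.Prime) (hwl : w (l : N) = 1) {x : Nˣ}
    (hx : x ^ l ∈ valueSaturation w T) : x ∈ valueSaturation w T := by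
  by_contra hxT
  obtain ⟨t, ht, htx⟩ := mem_valueSaturation.mp hx
  have : NeZero (l : N) := ⟨by
    rintro h
    simp [h] at hwl⟩
  -- An `l`-th root of `t` has the value of `x`. Adjoining it to `T` gives a larger tame radical
  -- group, against maximality.
  obtain ⟨z, hz⟩ := IsSepClosed.exists_pow_nat_eq (t : N) l
  have hz0 : z ≠ 0 := by
    rintro rfl
    rw [zero_pow hl.ne_zero] at hz
    exact t.ne_zero hz.symm
  let s : Nˣ := Units.mk0 z hz0
  have hst : s ^ l = t := Units.ext hz
  have hsx : w (s : N) = w (x : N) := by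
    rw [← hst, Units.val_pow_eq_pow_val, Units.val_pow_eq_pow_val, map_pow, map_pow] at htx
    exact (pow_left_inj₀ zero_le zero_le hl.ne_zero).mp htx
  have hsT : s ∉ valueSaturation w T := by
    rw [mem_valueSaturation] at hxT ⊢
    rwa [hsx]
  have hsl : s ^ l ∈ T := hst ▸ ht
  -- If `l` did not divide `i`, a Bézout relation would put `s` itself into the saturation.
  have hzpow : ∀ i : ℤ, s ^ i ∈ valueSaturation w T → s ^ i ∈ T := by
    intro i hi
    by_cases hdvd : (l : ℤ) ∣ i
    · obtain ⟨j, rfl⟩ := hdvd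
      rw [zpow_mul, zpow_natCast]
      exact zpow_mem hsl j
    · exfalso
      obtain ⟨a, b, hab⟩ := (Prime.coprime_iff_not_dvd (Nat.prime_iff_prime_int.mp hl)).mpr hdvd
      apply hsT
      rw [← zpow_one s, ← hab, zpow_add, mul_comm a, mul_comm b, zpow_mul, zpow_mul, zpow_natCast]
      exact mul_mem (zpow_mem (le_valueSaturation T hsl) a) (zpow_mem hi b)
  have hT' : IsTameRadicalGroup F w (T ⊔ Subgroup.zpowers s) := by
    refine ⟨hT.1.range_le.trans le_sup_left, fun y hy => ?_, fun y hy hy1 => ?_⟩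
    · obtain ⟨t', ht', _, ⟨i, rfl⟩, rfl⟩ := Subgroup.mem_sup.mp hy
      obtain ⟨n, hn, htn⟩ := hT.1.exists_pow_mem t' ht'
      obtain ⟨m, hm, hsm⟩ := hT.1.exists_pow_mem _ hsl
      refine ⟨n * (l * m), by push_cast; simp [hn, hm, hwl], ?_⟩
      have h1 : (t' * s ^ i) ^ (n * (l * m)) = (t' ^ n) ^ (l * m) * (((s ^ l) ^ m) ^ i) ^ n := by
        rw [mul_pow, ← pow_mul, ← pow_mul s, ← zpow_natCast, ← zpow_natCast s, ← zpow_natCast,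
          ← zpow_natCast, ← zpow_mul, ← zpow_mul, ← zpow_mul]
        push_cast
        ring_nf
      beta_reduce
      rw [h1]
      exact mul_mem (pow_mem htn _) (pow_mem (zpow_mem hsm _) _)
    · obtain ⟨t', ht', _, ⟨i, rfl⟩, rfl⟩ := Subgroup.mem_sup.mp hy
      have h1 : s ^ i ∈ T := by
        refine hzpow i (mem_valueSaturation.mpr ⟨t'⁻¹, inv_mem ht', ?_⟩)
        rw [Units.val_mul, map_mul] at hy1
        rw [Units.val_inv_eq_inv_val, map_inv₀]
        exact inv_eq_of_mul_eq_one_right hy1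
      exact hT.1.mem_range_of_eq_one _ (mul_mem ht' h1) hy1
  have hle := hT.2 hT' le_sup_left
  exact hsT (le_valueSaturation T (hle (le_sup_right (a := T) (Subgroup.mem_zpowers s))))

/-- Every value of an algebraic extension has a power among the values of the base field. -/
theorem exists_pow_mem_valueSaturation [IsGalois F N]
    (hw : ∀ (σ : Gal(N/F)) (x : N), w (σ x) = w x) (x : Nˣ) :
    ∃ n : ℕ, n ≠ 0 ∧ x ^ n ∈ valueSaturation w (Units.map (algebraMap F N : F →* N)).range := by
  let L := FiniteGaloisIntermediateField.adjoin F {(x : N)}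
  have hxL : (x : N) ∈ L.toIntermediateField :=
    FiniteGaloisIntermediateField.subset_adjoin F {(x : N)} rfl
  let y : L := ⟨x, hxL⟩
  -- The norm is a product of this many conjugates, all of the same value.
  refine ⟨Fintype.card Gal(L/F), Fintype.card_ne_zero, ?_⟩
  have h1 : w (algebraMap F N (Algebra.norm F y)) = w x ^ Fintype.card Gal(L/F) := by
    have h2 := congrArg (algebraMap L N) (Algebra.norm_eq_prod_automorphisms F y)
    rw [map_prod] at h2
    rw [IsScalarTower.algebraMap_apply F L N, h2, map_prod, Finset.prod_congr rfl fun σ _ => ?_,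
      Finset.prod_const, Finset.card_univ]
    obtain ⟨τ, rfl⟩ := AlgEquiv.restrictNormalHom_surjective (F := F) (K₁ := L) N σ
    exact (congrArg w (AlgEquiv.restrictNormalHom_apply _ τ y)).trans (hw τ _)
  have hne : Algebra.norm F y ≠ 0 := by
    rw [Algebra.norm_ne_zero_iff]
    exact fun h => x.ne_zero (congrArg Subtype.val h)
  refine mem_valueSaturation.mpr ⟨_, ⟨Units.mk0 _ hne, rfl⟩, ?_⟩
  simpa using h1

end ValuedGalois

/-! ### Linear disjointness from the inertia field -/

theorem List.exists_perm_cons_cons_of_not_pairwise {α : Type*} {R : α → α → Prop} {l : List α}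
    (h : ¬ l.Pairwise R) : ∃ a b l', l.Perm (a :: b :: l') ∧ ¬ R a b := by
  classical
  induction l with
  | nil => simp at h
  | cons a t ih =>
    rw [List.pairwise_cons, not_and_or] at h
    by_cases ht : t.Pairwise R
    · have h1 := h.resolve_right (not_not.mpr ht)
      push Not at h1
      obtain ⟨b, hb, hab⟩ := h1
      exact ⟨a, b, t.erase b, (List.perm_cons_erase hb).cons a, hab⟩
    · obtain ⟨c, d, t', hp, hcd⟩ := ih ht
      refine ⟨c, d, a :: t', (hp.cons a).trans ?_, hcd⟩
      exact (List.Perm.swap c a _).trans ((List.Perm.swap d a _).cons c)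

/-- A nonempty sum of terms of distinct values has the value of one of its terms. -/
theorem Valuation.exists_mem_map_sum_eq_of_pairwise_ne {R Γ : Type*} [Ring R]
    [LinearOrderedCommGroupWithZero Γ] (w : Valuation R Γ) {l : List R} (hl : l ≠ [])
    (h : l.Pairwise fun a b => w a ≠ w b) : ∃ a ∈ l, w l.sum = w a := by
  induction l with
  | nil => exact absurd rfl hl
  | cons a t ih =>
    rcases eq_or_ne t [] with rfl | ht
    · exact ⟨a, by simp⟩
    rw [List.pairwise_cons] at h
    obtain ⟨b, hb, hbt⟩ := ih ht h.2
    have hne : w a ≠ w t.sum := hbt ▸ h.1 b hb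
    rw [List.sum_cons]
    rcases hne.lt_or_gt with hlt | hlt
    · exact ⟨b, List.mem_cons_of_mem a hb, by rw [w.map_add_eq_of_lt_right hlt, hbt]⟩
    · exact ⟨a, List.mem_cons_self, by rw [w.map_add_eq_of_lt_left hlt]⟩

namespace ValuedGalois

variable {F N Γ : Type*} [Field F] [Field N] [Algebra F N]
  [LinearOrderedCommGroupWithZero Γ] {w : Valuation N Γ} {T : Subgroup Nˣ}

theorem IsTameRadicalGroup.algebraMap_mul_mem (hT : IsTameRadicalGroup F w T) {a : F} (ha : a ≠ 0)
    {t : Nˣ} (ht : t ∈ T) : Units.map (algebraMap F N : F →* N) (Units.mk0 a ha) * t ∈ T :=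
  mul_mem (hT.range_le ⟨_, rfl⟩) ht

/-- Two elements of a tame radical group whose values differ by a value of `F` differ by a factor
in `F`. -/
theorem IsTameRadicalGroup.exists_eq_algebraMap_mul (hT : IsTameRadicalGroup F w T) {s t : Nˣ}
    (hs : s ∈ T) (ht : t ∈ T) {a : F} (ha : w (s : N) = w (algebraMap F N a) * w (t : N)) :
    ∃ b : F, (s : N) = algebraMap F N b * t := by
  have ha0 : a ≠ 0 := by
    rintro rfl
    simp at ha
  have h1 : s * (Units.map (algebraMap F N : F →* N) (Units.mk0 a ha0) * t)⁻¹ ∈ T :=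
    mul_mem hs (inv_mem (hT.algebraMap_mul_mem ha0 ht))
  obtain ⟨c, hc⟩ := hT.mem_range_of_eq_one _ h1 (by
    have h2 : w (algebraMap F N a) * w (t : N) ≠ 0 := by simp [ha0]
    rw [Units.val_mul, Units.val_inv_eq_inv_val, map_mul, map_inv₀, ha, Units.val_mul, map_mul]
    exact mul_inv_cancel₀ h2)
  refine ⟨c * a, ?_⟩
  rw [eq_mul_inv_iff_mul_eq] at hc
  have h3 := congrArg Units.val hc
  rw [← h3, map_mul]
  simp [mul_assoc]

theorem IsTameRadicalGroup.exists_list_sum_eq (hT : IsTameRadicalGroup F w T) {x : N}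
    (hx : x ∈ Submodule.span F (Units.val '' (T : Set Nˣ))) :
    ∃ l : List N, (∀ y ∈ l, ∃ t ∈ T, (t : N) = y) ∧ l.sum = x := by
  induction hx using Submodule.span_induction with
  | mem y hy =>
    obtain ⟨t, ht, rfl⟩ := hy
    exact ⟨[t], by simpa using ⟨t, ht, rfl⟩, by simp⟩
  | zero => exact ⟨[], by simp⟩
  | add y z _ _ hy hz =>
    obtain ⟨l, hl, rfl⟩ := hy
    obtain ⟨m, hm, rfl⟩ := hz
    exact ⟨l ++ m, fun y hy => (List.mem_append.mp hy).elim (hl y) (hm y), by simp⟩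
  | smul a y _ hy =>
    obtain ⟨l, hl, rfl⟩ := hy
    rcases eq_or_ne a 0 with rfl | ha
    · exact ⟨[], by simp⟩
    refine ⟨l.map (a • ·), fun y hy => ?_, (List.smul_sum).symm⟩
    obtain ⟨z, hz, rfl⟩ := List.mem_map.mp hy
    obtain ⟨t, ht, rfl⟩ := hl z hz
    exact ⟨_, hT.algebraMap_mul_mem ha ht, by simp [Algebra.smul_def]⟩

/-- Two terms with values congruent modulo those of `F` are proportional over `F` and merge into one
term or cancel. If there are none, the sum has the value of one term; being in the inertia field it
has a value from `F`, so that term lies in `F` and can be removed. -/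
theorem IsTameRadicalGroup.sum_mem_range [IsGalois F N] (hT : IsTameRadicalGroup F w T)
    (hw : ∀ (σ : Gal(N/F)) (x : N), w (σ x) = w x) (l : List N)
    (hl : ∀ y ∈ l, ∃ t ∈ T, (t : N) = y) (hsum : l.sum ∈ inertiaField F w) :
    l.sum ∈ (algebraMap F N).range := by
  classical
  induction hn : l.length using Nat.strong_induction_on generalizing l with
  | _ n ih =>
    subst hn
    rcases eq_or_ne l [] with rfl | hnil
    · exact ⟨0, by simp⟩
    by_cases hpair : l.Pairwise fun a b => ∀ c : F, w a ≠ w (algebraMap F N c) * w b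
    · obtain ⟨y, hy, hwy⟩ := w.exists_mem_map_sum_eq_of_pairwise_ne hnil
        (hpair.imp fun h => by simpa using h 1)
      obtain ⟨a, ha⟩ := exists_map_algebraMap_eq_of_mem_inertiaField hw hsum
      obtain ⟨t, ht, rfl⟩ := hl y hy
      obtain ⟨b, hb⟩ := hT.exists_eq_algebraMap_mul ht (one_mem T) (a := a) (by simp [ha, hwy])
      rw [Units.val_one, mul_one] at hb
      have hperm := List.perm_cons_erase hy
      have hlen := hperm.length_eq
      rw [hperm.sum_eq, List.sum_cons] at hsum ⊢
      have ht' : (t : N) ∈ inertiaField F w := hb ▸ IntermediateField.algebraMap_mem _ b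
      refine add_mem ⟨b, hb.symm⟩ (ih _ ?_ _ (fun x hx => hl x (List.mem_of_mem_erase hx))
        ((add_mem_cancel_left ht').mp hsum) rfl)
      rw [hlen]
      simp
    · obtain ⟨y, z, l', hperm, hyz⟩ := List.exists_perm_cons_cons_of_not_pairwise hpair
      push Not at hyz
      obtain ⟨c, hc⟩ := hyz
      have hl' : ∀ x ∈ y :: z :: l', ∃ t ∈ T, (t : N) = x := fun x hx =>
        hl x (hperm.mem_iff.mpr hx)
      obtain ⟨s, hs, hsy⟩ := hl' y (by simp)
      obtain ⟨t, ht, rfl⟩ := hl' z (by simp)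
      subst hsy
      obtain ⟨b, hb⟩ := hT.exists_eq_algebraMap_mul hs ht hc
      have hlen := hperm.length_eq
      rw [hperm.sum_eq] at hsum ⊢
      have hadd : (s : N) + t = algebraMap F N (b + 1) * t := by rw [hb, map_add, map_one]; ring
      rw [List.sum_cons, List.sum_cons, ← add_assoc, hadd] at hsum ⊢
      rcases eq_or_ne (b + 1) 0 with h0 | h0
      · rw [h0, map_zero, zero_mul, zero_add] at hsum ⊢
        refine ih _ ?_ l' (fun x hx => hl' x (by simp [hx])) hsum rfl
        simp only [List.length_cons] at hlen
        omega
      · rw [← List.sum_cons] at hsum ⊢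
        refine ih _ ?_ _ (fun x hx => ?_) hsum rfl
        · simp only [List.length_cons] at hlen ⊢
          omega
        · rcases List.mem_cons.mp hx with rfl | hx
          · exact ⟨_, hT.algebraMap_mul_mem h0 ht, by simp⟩
          · exact hl' x (by simp [hx])

/-- As `N` is algebraic over `F` and `T` is closed under products, F(T) is just the `F`-span of `T`.
-/
theorem IsTameRadicalGroup.inertiaField_inf_adjoin [IsGalois F N] (hT : IsTameRadicalGroup F w T)
    (hw : ∀ (σ : Gal(N/F)) (x : N), w (σ x) = w x) :
    inertiaField F w ⊓ IntermediateField.adjoin F (Units.val '' (T : Set Nˣ)) = ⊥ := by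
  rw [eq_bot_iff]
  rintro x ⟨hx, hxT⟩
  have h1 : x ∈ Submodule.span F (Units.val '' (T : Set Nˣ)) := by
    have h2 : x ∈ Algebra.adjoin F (Units.val '' (T : Set Nˣ)) := by
      rw [← IntermediateField.adjoin_toSubalgebra]
      exact hxT
    have h3 : Units.val '' (T : Set Nˣ) = (T.toSubmonoid.map (Units.coeHom N) : Set N) := rfl
    rw [h3] at h2 ⊢
    rw [← Subalgebra.mem_toSubmodule, Algebra.adjoin_eq_span, Submonoid.closure_eq] at h2
    exact h2
  obtain ⟨l, hl, rfl⟩ := hT.exists_list_sum_eq h1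
  exact hT.sum_mem_range hw l hl hx

/-! ### Generation of the ramification field -/

/-- An element of the inertia group that fixes a maximal tame radical group lies in the
ramification group. -/
theorem mem_ramificationGroup_of_fixes [IsSepClosed N] [IsGalois F N]
    (hw : ∀ (σ : Gal(N/F)) (x : N), w (σ x) = w x) (hT : Maximal (IsTameRadicalGroup F w) T)
    {σ : Gal(N/F)} (hσ : σ ∈ inertiaGroup F w) (hσT : ∀ t ∈ T, σ (t : N) = t) :
    σ ∈ ramificationGroup F w := by
  have key : ∀ n : ℕ, n ≠ 0 → ∀ x : Nˣ, x ^ n ∈ valueSaturation w T → w (σ x / x - 1) < 1 := by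
    intro n
    induction n using Nat.strong_induction_on with
    | _ n ih =>
      intro hn x hx
      rcases eq_or_ne n 1 with rfl | hn1
      · rw [pow_one] at hx
        obtain ⟨t, ht, htx⟩ := mem_valueSaturation.mp hx
        have ht0 : w (t : N) ≠ 0 := by simp
        have hy : w ((x : N) / t) = 1 := by rw [map_div₀, htx, div_self (htx ▸ ht0)]
        have h1 := hσ _ hy.le
        rw [map_div₀, hσT t ht] at h1
        have h2 : σ x / x - 1 = (σ x / t - x / t) / (x / t) := by
          field_simp
        rwa [h2, map_div₀, hy, div_one]
      obtain ⟨m, hm⟩ := n.minFac_dvd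
      set l := n.minFac
      have hl : l.Prime := Nat.minFac_prime hn1
      have hm0 : m ≠ 0 := by
        rintro rfl
        exact hn (by rw [hm, mul_zero])
      have hmn : m < n := by
        rw [hm]
        exact lt_mul_of_one_lt_left (Nat.pos_of_ne_zero hm0) hl.one_lt
      have hlB : (l : N) ∈ w.valuationSubring := natCast_mem _ l
      rcases (show w (l : N) ≤ 1 from hlB).lt_or_eq with hlt | heq
      · have h1 := ih m hmn hm0 (x ^ l) (by rwa [← pow_mul, ← hm])
        rw [Units.val_pow_eq_pow_val, map_pow, ← div_pow] at h1
        have hu : w (σ x / x) = 1 := by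
          rw [map_div₀, hw, div_self (by simp)]
        let B := w.valuationSubring
        let u : B := ⟨σ x / x, hu.le⟩
        -- Here `l` is the residue characteristic, and Frobenius is injective on the residue field:
        -- if u^l is congruent to 1, so is `u`.
        obtain ⟨r, hr⟩ : ∃ r : B, (u - 1 + 1) ^ l = (u - 1) ^ l + 1 + l * r := by
          obtain ⟨r, hr⟩ := exists_add_pow_prime_eq hl (u - 1) 1
          exact ⟨(u - 1) * r, by rw [hr, one_pow]; ring⟩
        have h2 : (σ x / x - 1) ^ l = ((σ x / x) ^ l - 1) + -((l : N) * (r : N)) := by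
          have h3 := congrArg (Subtype.val : B → N) hr
          rw [sub_add_cancel] at h3
          simp [u] at h3
          rw [h3]
          ring
        have h4 : w (σ x / x - 1) ^ l < 1 := by
          rw [← map_pow, h2]
          refine w.map_add_lt h1 ?_
          rw [w.map_neg, map_mul]
          exact mul_lt_one_of_lt_of_le hlt r.2
        exact (pow_lt_one_iff_of_nonneg zero_le hl.ne_zero).mp h4
      -- A prime other than the residue characteristic can be cancelled from the exponent, by
      -- maximality of `T`.
      · exact ih m hmn hm0 x (mem_valueSaturation_of_pow_mem hT hl heq (by
          rwa [← pow_mul, mul_comm, ← hm]))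
  intro x hx
  obtain ⟨n, hn, hxn⟩ := exists_pow_mem_valueSaturation hw (Units.mk0 x hx)
  refine key n hn (Units.mk0 x hx) ?_
  obtain ⟨t, ht, htx⟩ := mem_valueSaturation.mp hxn
  exact mem_valueSaturation.mpr ⟨t, hT.1.range_le ht, htx⟩

/-- The ramification group fixes each tame radical group. -/
theorem IsTameRadicalGroup.apply_eq_self (hT : IsTameRadicalGroup F w T) {σ : Gal(N/F)}
    (hσ : σ ∈ ramificationGroup F w) {t : Nˣ} (ht : t ∈ T) : σ (t : N) = t := by
  obtain ⟨n, hn, a, ha⟩ := hT.exists_pow_mem t ht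
  have han : algebraMap F N a = (t : N) ^ n := congrArg Units.val ha
  set z : N := σ t / t with hz
  have hz1 : w (z - 1) < 1 := hσ t t.ne_zero
  have hzn : z ^ n = 1 := by
    rw [hz, div_pow, ← map_pow, ← han, σ.commutes, han, div_self (pow_ne_zero _ t.ne_zero)]
  by_contra hne
  have hz0 : z - 1 ≠ 0 := by
    rw [hz, sub_ne_zero]
    intro h
    exact hne ((div_eq_one_iff_eq t.ne_zero).mp h)
  -- For a nontrivial `n`-th root of unity this sum vanishes, but `z` has residue 1, so the sum has
  -- the residue of `n`, which is nonzero.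
  have hgeom : ∑ i ∈ Finset.range n, z ^ i = 0 := by
    have := geom_sum_mul z n
    rw [hzn, sub_self] at this
    exact (mul_eq_zero.mp this).resolve_right hz0
  have hzB : w z ≤ 1 := by
    have := w.map_add_le hz1.le w.map_one.le
    simpa using this
  have hpow : ∀ i : ℕ, w (z ^ i - 1) < 1 := by
    intro i
    rw [← mul_geom_sum, map_mul]
    refine mul_lt_one_of_lt_of_le hz1 ?_
    exact w.map_sum_le fun j _ => by
      rw [map_pow]
      exact pow_le_one₀ zero_le hzB
  have h1 : w (∑ i ∈ Finset.range n, (z ^ i - 1)) < 1 := w.map_sum_lt one_ne_zero fun i _ => hpow i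
  rw [Finset.sum_sub_distrib, hgeom, zero_sub, w.map_neg] at h1
  simp [hn] at h1

theorem inertiaField_sup_adjoin [IsSepClosed N] [IsGalois F N]
    (hw : ∀ (σ : Gal(N/F)) (x : N), w (σ x) = w x) (hT : Maximal (IsTameRadicalGroup F w) T) :
    inertiaField F w ⊔ IntermediateField.adjoin F (Units.val '' (T : Set Nˣ)) =
      ramificationField F w := by
  have hfix : (inertiaField F w ⊔
      IntermediateField.adjoin F (Units.val '' (T : Set Nˣ))).fixingSubgroup =
      ramificationGroup F w := by
    apply le_antisymm
    · intro σ hσ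
      rw [IntermediateField.fixingSubgroup_sup, fixingSubgroup_inertiaField] at hσ
      refine mem_ramificationGroup_of_fixes hw hT hσ.1 fun t ht => ?_
      exact hσ.2 ⟨t, IntermediateField.subset_adjoin F _ ⟨t, ht, rfl⟩⟩
    · rw [← IntermediateField.le_iff_le]
      refine sup_le (inertiaField_le_ramificationField F w) ?_
      rw [IntermediateField.adjoin_le_iff]
      rintro _ ⟨t, ht, rfl⟩ ⟨σ, hσ⟩
      exact hT.1.apply_eq_self hσ ht
  rw [← InfiniteGalois.fixedField_fixingSubgroup (inertiaField F w ⊔ _), hfix, ramificationField]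

end ValuedGalois

end

/-! ### From a field complement to a continuous section -/

namespace ValuedGalois

variable {F N : Type*} [Field F] [Field N] [Algebra F N]

/-- An automorphism of `L` over `K`, as an automorphism over the base field. -/
def galoisInclusion {K L : IntermediateField F N} (h : K ≤ L) :
    Gal(IntermediateField.extendScalars h/K) →* Gal(L/F) where
  toFun τ := (τ.restrictScalars F : Gal(IntermediateField.extendScalars h/F))
  map_one' := rfl
  map_mul' _ _ := rfl

/-- Restriction of automorphisms of `L` to a normal subextension `K`. -/
noncomputable def galoisRestriction {K L : IntermediateField F N} (h : K ≤ L) [Normal F K] :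
    Gal(L/F) →* Gal(K/F) :=
  letI := (IntermediateField.inclusion h).toAlgebra
  haveI : IsScalarTower F K L := IsScalarTower.of_algebraMap_eq fun _ => rfl
  AlgEquiv.restrictNormalHom K

theorem galoisRestriction_apply {K L : IntermediateField F N} (h : K ≤ L) [Normal F K]
    (σ : Gal(L/F)) (x : K) :
    ((galoisRestriction h σ x : K) : N) = (σ (IntermediateField.inclusion h x) : N) := by
  let := (IntermediateField.inclusion h).toAlgebra
  have : IsScalarTower F K L := IsScalarTower.of_algebraMap_eq fun _ => rfl
  exact congrArg Subtype.val (AlgEquiv.restrictNormal_commutes σ K x)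

theorem galoisRestriction_restrictNormalHom {K L : IntermediateField F N} (h : K ≤ L)
    [Normal F K] [Normal F L] (σ : Gal(N/F)) :
    galoisRestriction h (AlgEquiv.restrictNormalHom L σ) = AlgEquiv.restrictNormalHom K σ := by
  ext x
  rw [galoisRestriction_apply, AlgEquiv.restrictNormalHom_apply, AlgEquiv.restrictNormalHom_apply]
  rfl

theorem range_galoisInclusion {K L : IntermediateField F N} (h : K ≤ L) [Normal F K] :
    (galoisInclusion h).range = (galoisRestriction h).ker := by
  ext σ
  constructor
  · rintro ⟨τ, rfl⟩
    rw [MonoidHom.mem_ker]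
    ext x
    rw [galoisRestriction_apply]
    exact congrArg Subtype.val (τ.commutes x)
  · intro hσ
    rw [MonoidHom.mem_ker] at hσ
    let τ : Gal(IntermediateField.extendScalars h/K) :=
      { (σ : L ≃+* L) with
        commutes' := fun x => by
          refine Subtype.ext ?_
          have h1 := galoisRestriction_apply h σ x
          rw [hσ] at h1
          exact h1.symm }
    exact ⟨τ, rfl⟩

/-- The canonical sequence of Galois groups. -/
noncomputable def galoisGroupExtension [IsGalois F N] {K L : IntermediateField F N} (h : K ≤ L)
    [Normal F K] [Normal F L] :
    GroupExtension Gal(IntermediateField.extendScalars h/K) Gal(L/F) Gal(K/F) where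
  inl := galoisInclusion h
  rightHom := galoisRestriction h
  inl_injective := fun σ τ hστ => AlgEquiv.ext fun x => DFunLike.congr_fun hστ x
  range_inl_eq_ker_rightHom := range_galoisInclusion h
  rightHom_surjective := fun σ => by
    obtain ⟨τ, rfl⟩ := AlgEquiv.restrictNormalHom_surjective (F := F) (K₁ := K) N σ
    exact ⟨AlgEquiv.restrictNormalHom L τ, galoisRestriction_restrictNormalHom h τ⟩

theorem isGaloisSequence_galoisGroupExtension [IsGalois F N] {K L : IntermediateField F N}
    (h : K ≤ L) [Normal F K] [Normal F L] : IsGaloisSequence h (galoisGroupExtension h) :=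
  ⟨fun _ _ => rfl, galoisRestriction_apply h⟩

/-- A field complement of `K` in `L` splits the canonical sequence of Galois groups. -/
theorem galoisSequenceSplits_of_sup_eq_of_inf_eq_bot [IsGalois F N] {K L F' : IntermediateField F N}
    (h : K ≤ L) [IsGalois F K] [IsGalois F L] (hsup : K ⊔ F' = L) (hinf : K ⊓ F' = ⊥) :
    GaloisSequenceSplits h := by
  let H := F'.fixingSubgroup
  have hH : IsCompact (H : Set Gal(N/F)) := (InfiniteGalois.fixingSubgroup_isClosed F').isCompact
  have : CompactSpace H := isCompact_iff_compactSpace.mp hH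
  let rK : Gal(N/F) →* Gal(K/F) := AlgEquiv.restrictNormalHom K
  let rL : Gal(N/F) →* Gal(L/F) := AlgEquiv.restrictNormalHom L
  have hrK : Continuous rK := InfiniteGalois.restrictNormalHom_continuous K
  have hrL : Continuous rL := InfiniteGalois.restrictNormalHom_continuous L
  have : T2Space Gal(K/F) := krullTopology_t2
  -- The image of `H` is compact, hence closed, and its fixed field is K ∩ F' = F.
  have hmap : H.map rK = ⊤ := by
    let I : ClosedSubgroup Gal(K/F) := ⟨H.map rK, (hH.image hrK).isClosed⟩
    have h1 := InfiniteGalois.restrict_fixedField H K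
    rw [InfiniteGalois.fixedField_fixingSubgroup, inf_comm, hinf] at h1
    have h2 : IntermediateField.fixedField (H.map rK) = ⊥ := by
      apply IntermediateField.lift_injective K
      rw [← h1, IntermediateField.lift_bot]
    have h3 := InfiniteGalois.fixingSubgroup_fixedField I
    rw [show IntermediateField.fixedField I.toSubgroup = ⊥ from h2,
      IntermediateField.fixingSubgroup_bot] at h3
    exact h3.symm
  let f : H →* Gal(K/F) := rK.comp H.subtype
  let g : H →* Gal(L/F) := rL.comp H.subtype
  have hf : Function.Surjective f := by
    intro σ
    obtain ⟨τ, hτ, rfl⟩ := (hmap ▸ Subgroup.mem_top σ : σ ∈ H.map rK)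
    exact ⟨⟨τ, hτ⟩, rfl⟩
  -- An element of `H` trivial on `K` fixes both `K` and `F'`, hence `L`; so restriction to `L`
  -- factors through restriction to `K`.
  have hker : f.ker ≤ g.ker := by
    intro τ hτ
    have h1 : (τ : Gal(N/F)) ∈ rK.ker := hτ
    have h2 : (τ : Gal(N/F)) ∈ rL.ker := by
      rw [IntermediateField.restrictNormalHom_ker] at h1 ⊢
      rw [← hsup, IntermediateField.fixingSubgroup_sup]
      exact ⟨h1, τ.2⟩
    exact h2
  let s : Gal(K/F) →* Gal(L/F) := f.liftOfSurjective hf ⟨g, hker⟩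
  have hs : ∀ τ : H, s (f τ) = g τ := f.liftOfRightInverse_comp_apply _ _ ⟨g, hker⟩
  have hfcont : Continuous f := hrK.comp continuous_subtype_val
  have hscont : Continuous s := by
    -- A continuous surjection from a compact space to a Hausdorff space is a quotient map.
    rw [(hfcont.isClosedMap.isQuotientMap hfcont hf).continuous_iff]
    exact (hrL.comp continuous_subtype_val).congr fun τ => (hs τ).symm
  refine ⟨galoisGroupExtension h, isGaloisSequence_galoisGroupExtension h,
    ⟨s, fun σ => ?_⟩, hscont⟩
  obtain ⟨τ, rfl⟩ := hf σ
  exact (congrArg (galoisRestriction h) (hs τ)).trans (galoisRestriction_restrictNormalHom h _)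

end ValuedGalois

theorem lemma2p1 {F Γ : Type*} [Field F] [LinearOrderedCommGroupWithZero Γ] (v : Valuation F Γ)
    [HenselianLocalRing v.valuationSubring]
    {Fs Γs : Type*} [Field Fs] [Algebra F Fs] [IsSepClosure F Fs]
    [LinearOrderedCommGroupWithZero Γs] (w : Valuation Fs Γs) [v.HasExtension w] :
    (∃ F' : IntermediateField F Fs,
      ValuedGalois.inertiaField F w ⊔ F' = ValuedGalois.ramificationField F w ∧
      ValuedGalois.inertiaField F w ⊓ F' = ⊥) ∧
    ValuedGalois.GaloisSequenceSplits (ValuedGalois.inertiaField_le_ramificationField F w) := by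
  have : IsSepClosed Fs := IsSepClosure.sep_closed F
  have : IsGalois F Fs := IsSepClosure.isGalois
  have hv : v.Integers v.valuationSubring := Valuation.integer.integers v
  have : IsScalarTower v.valuationSubring F Fs := IsScalarTower.of_algebraMap_eq fun _ => rfl
  have hw : ∀ (σ : Gal(Fs/F)) (x : Fs), w (σ x) = w x := hv.map_algEquiv_of_henselian w
  obtain ⟨T, hT⟩ := ValuedGalois.exists_maximal_isTameRadicalGroup F w
  have hsup := ValuedGalois.inertiaField_sup_adjoin hw hT
  have hinf := hT.1.inertiaField_inf_adjoin hw
  have := ValuedGalois.isGalois_inertiaField hw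
  have := ValuedGalois.isGalois_ramificationField hw
  exact ⟨⟨_, hsup, hinf⟩,
    ValuedGalois.galoisSequenceSplits_of_sup_eq_of_inf_eq_bot _ hsup hinf⟩
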